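/- Let $d\ge 1$ and $0<p<\infty$. Write $\langle x,y\rangle$ and $|x|$ for the Euclidean scalar product and norm on $\mathbb R^d$, $|z|=(|z_1|^2+\dots+|z_d|^2)^{1/2}$ and $\operatorname{Im} z=(\operatorname{Im} z_1,\dots,\operatorname{Im} z_d)$ for $z\in\mathbb C^d$. For a weight $w:\mathbb R^d\to[0,\infty)$ let $L^{p,w}$ be the set of Lebesgue measurable $f:\mathbb R^d\to\mathbb C$ with $\int_{\mathbb R^d}|f(x)|^p w(x)\,dx<\infty$. Consider functions $f\in L^{p,w}$ that extend to an entire function, again denoted $f$, on $\mathbb C^d$. For $\boldsymbol\sigma=(\sigma_1,\dots,\sigma_d)$ with all $\sigma_i>0$, let $B^{\boldsymbol\sigma}_{p,w}$ be the set of such $f$ for which, for every $\varepsilon>0$, there is a constant $c_\varepsilon$ with $|f(z)|\le c_\varepsilon e^{(\sigma_1+\varepsilon)|z_1|+\dots+(\sigma_d+\varepsilon)|z_d|}$ for all $z\in\mathbb C^d$, and let $\tilde B^{\boldsymbol\sigma}_{p,w}$ be the set of such $f$ for which there is a constant $c$ with $|f(z)|\le c\,e^{\sigma_1|\operatorname{Im}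 z_1|+\dots+\sigma_d|\operatorname{Im} z_d|}$ for all $z\in\mathbb C^d$. For a number $\sigma>0$, let $B^{\sigma}_{p,w}$ be the set of such $f$ for which, for every $\varepsilon>0$, there is a constant $c_\varepsilon$ with $|f(z)|\le c_\varepsilon e^{(\sigma+\varepsilon)|z|}$ for all $z\in\mathbb C^d$, and let $\tilde B^{\sigma}_{p,w}$ be the set of such $f$ for which there is a constant $c$ with $|f(z)|\le c\,e^{\sigma|\operatorname{Im} z|}$ for all $z\in\mathbb C^d$. When $w\equiv1$ the index $w$ is omitted. **Theorem.** Let $m\ge 0$ be an integer, $\alpha^1,\dots,\alpha^m\in\mathbb R^d\setminus\{0\}$, $k_0\ge0$, $k_1,\dots,k_m>0$, and $v(x)=|x|^{k_0}\prod_{j=1}^m|\langle\alpha^j,x\rangle|^{k_j}$. Then, for every $\boldsymbol\sigma$ with positive coordinates and every number $\sigma>0$, 1. $B^{\boldsymbol\sigma}_{p,v}\subset B^{\boldsymbol\sigma}_{p}$; 2. $B^{\boldsymbol\sigma}_{p,v}=\tilde B^{\boldsymbol\sigma}_{p,v}$; 3. $B^{\sigma}_{p,v}=\tilde B^{\sigma}_{p,v}$.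 In particular, let $R\subset\mathbb R^d\setminus\{0\}$ be a finite root system, that is, $R\cap\mathbb Ra=\{a,-a\}$ and $\sigma_aR=R$ for all $a\in R$, where $\sigma_a$ is the reflection in the hyperplane $\langle a,x\rangle=0$. Let $R_+$ be a positive subsystem (the roots $a$ with $\langle\beta,a\rangle>0$, for some $\beta\in\mathbb R^d$ orthogonal to no root), let $k:R\to[0,\infty)$ be invariant under the group generated by the reflections $\sigma_a$, $a\in R$, let $v_k(x)=\prod_{a\in R_+}|\langle a,x\rangle|^{2k(a)}$ and $c_k^{-1}=\int_{\mathbb R^d}e^{-|x|^2/2}v_k(x)\,dx$, and write $B^\sigma_{p,k}$, $\tilde B^\sigma_{p,k}$ for the classes $B^\sigma_{p,w}$, $\tilde B^\sigma_{p,w}$ with $w=c_kv_k$. Then $B^\sigma_{p,k}=\tilde B^\sigma_{p,k}$ for every number $\sigma>0$. -/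

import Mathlib

open MeasureTheory

noncomputable section

/-- The inclusion of `ℝ^d` into `ℂ^d` (both with their Euclidean / Hermitian norms). -/
def realToComplex {d : ℕ} (x : EuclideanSpace ℝ (Fin d)) : EuclideanSpace ℂ (Fin d) :=
  WithLp.toLp 2 fun i => (x i : ℂ)

/-- The imaginary part `Im z = (Im z_1, …, Im z_d)` of `z ∈ ℂ^d`. -/
def imPart {d : ℕ} (z : EuclideanSpace ℂ (Fin d)) : EuclideanSpace ℝ (Fin d) :=
  WithLp.toLp 2 fun i => (z i).im

/-- `F` is an analytic continuation of `f : ℝ^d → ℂ` to an entire function on `ℂ^d`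
(unique when it exists). -/
def IsEntireExtension {d : ℕ} (f : EuclideanSpace ℝ (Fin d) → ℂ)
    (F : EuclideanSpace ℂ (Fin d) → ℂ) : Prop :=
  Differentiable ℂ F ∧ ∀ x, F (realToComplex x) = f x

/-- The power weight `v(x) = |x|^{k₀} ∏_j |⟨α^j, x⟩|^{k_j}`. -/
def powerWeight {d m : ℕ} (α : Fin m → EuclideanSpace ℝ (Fin d)) (k₀ : ℝ) (k : Fin m → ℝ)
    (x : EuclideanSpace ℝ (Fin d)) : ℝ :=
  ‖x‖ ^ k₀ * ∏ j, |inner ℝ (α j) x| ^ k j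

/-- The space `L^{p,w}(ℝ^d)`: Lebesgue measurable functions `f : ℝ^d → ℂ` for which
`∫ |f(x)|^p w(x) dx` is finite. -/
def weightedLp {d : ℕ} (p : ℝ) (w : EuclideanSpace ℝ (Fin d) → ℝ) :
    Set (EuclideanSpace ℝ (Fin d) → ℂ) :=
  {f | AEStronglyMeasurable f volume ∧ ∫⁻ x, ‖f x‖ₑ ^ p * ENNReal.ofReal (w x) < ⊤}

/-- The anisotropic class `B^σ_{p,w}`, `σ = (σ_1, …, σ_d)`. -/
def anisoClass {d : ℕ} (p : ℝ) (w : EuclideanSpace ℝ (Fin d) → ℝ) (σ : Fin d → ℝ) :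
    Set (EuclideanSpace ℝ (Fin d) → ℂ) :=
  {f | f ∈ weightedLp p w ∧ ∃ F, IsEntireExtension f F ∧
    ∀ ε > 0, ∃ c : ℝ, ∀ z, ‖F z‖ ≤ c * Real.exp (∑ i, (σ i + ε) * ‖z i‖)}

/-- The anisotropic class `B̃^σ_{p,w}`, `σ = (σ_1, …, σ_d)`. -/
def anisoClassTilde {d : ℕ} (p : ℝ) (w : EuclideanSpace ℝ (Fin d) → ℝ) (σ : Fin d → ℝ) :
    Set (EuclideanSpace ℝ (Fin d) → ℂ) :=
  {f | f ∈ weightedLp p w ∧ ∃ F, IsEntireExtension f F ∧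
    ∃ c : ℝ, ∀ z, ‖F z‖ ≤ c * Real.exp (∑ i, σ i * |(z i).im|)}

/-- The spherical class `B^σ_{p,w}`, `σ` a number. -/
def sphericalClass {d : ℕ} (p : ℝ) (w : EuclideanSpace ℝ (Fin d) → ℝ) (σ : ℝ) :
    Set (EuclideanSpace ℝ (Fin d) → ℂ) :=
  {f | f ∈ weightedLp p w ∧ ∃ F, IsEntireExtension f F ∧
    ∀ ε > 0, ∃ c : ℝ, ∀ z, ‖F z‖ ≤ c * Real.exp ((σ + ε) * ‖z‖)}

/-- The spherical class `B̃^σ_{p,w}`, `σ` a number. -/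
def sphericalClassTilde {d : ℕ} (p : ℝ) (w : EuclideanSpace ℝ (Fin d) → ℝ) (σ : ℝ) :
    Set (EuclideanSpace ℝ (Fin d) → ℂ) :=
  {f | f ∈ weightedLp p w ∧ ∃ F, IsEntireExtension f F ∧
    ∃ c : ℝ, ∀ z, ‖F z‖ ≤ c * Real.exp (σ * ‖imPart z‖)}

/-- The reflection of `ℝ^d` in the hyperplane `⟨a, x⟩ = 0`. -/
def hyperplaneReflection {d : ℕ} (a : EuclideanSpace ℝ (Fin d)) :
    EuclideanSpace ℝ (Fin d) ≃ₗᵢ[ℝ] EuclideanSpace ℝ (Fin d) :=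
  (Submodule.span ℝ {a})ᗮ.reflection

/-- A finite (reduced, not necessarily crystallographic or spanning) root system in `ℝ^d`. -/
structure IsDunklRootSystem {d : ℕ} (R : Finset (EuclideanSpace ℝ (Fin d))) : Prop where
  zero_notMem : 0 ∉ R
  inter_line : ∀ a ∈ R, (R : Set (EuclideanSpace ℝ (Fin d))) ∩ Submodule.span ℝ {a} = {a, -a}
  reflection_image : ∀ a ∈ R,
    hyperplaneReflection a '' (R : Set (EuclideanSpace ℝ (Fin d))) = R

/-- `Rp` is a positive subsystem of `R`: the roots lying on one side of a hyperplane through the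
origin that contains no root. -/
def IsPositiveSubsystem {d : ℕ} (R Rp : Finset (EuclideanSpace ℝ (Fin d))) : Prop :=
  ∃ β : EuclideanSpace ℝ (Fin d), (∀ a ∈ R, inner ℝ β a ≠ 0) ∧
    ∀ a, a ∈ Rp ↔ a ∈ R ∧ 0 < inner ℝ β a

/-- The reflection group `G(R)`. -/
def reflectionGroup {d : ℕ} (R : Finset (EuclideanSpace ℝ (Fin d))) :
    Subgroup (EuclideanSpace ℝ (Fin d) ≃ₗᵢ[ℝ] EuclideanSpace ℝ (Fin d)) :=
  Subgroup.closure (hyperplaneReflection '' (R : Set (EuclideanSpace ℝ (Fin d))))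

/-- `k` is a nonnegative `G(R)`-invariant function on `R` (its values off `R` play no role). -/
def IsMultiplicity {d : ℕ} (R : Finset (EuclideanSpace ℝ (Fin d)))
    (k : EuclideanSpace ℝ (Fin d) → ℝ) : Prop :=
  (∀ a ∈ R, 0 ≤ k a) ∧ ∀ g ∈ reflectionGroup R, ∀ a ∈ R, k (g a) = k a

/-- The Dunkl weight `v_k(x) = ∏_{a ∈ R₊} |⟨a, x⟩|^{2 k(a)}`. -/
def dunklWeight {d : ℕ} (Rp : Finset (EuclideanSpace ℝ (Fin d)))
    (k : EuclideanSpace ℝ (Fin d) → ℝ) (x : EuclideanSpace ℝ (Fin d)) : ℝ :=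
  ∏ a ∈ Rp, |inner ℝ a x| ^ (2 * k a)

/-- The density `c_k v_k` of the measure `μ_k`, where `c_k⁻¹ = ∫ e^{-|x|²/2} v_k(x) dx`. -/
def dunklDensity {d : ℕ} (Rp : Finset (EuclideanSpace ℝ (Fin d)))
    (k : EuclideanSpace ℝ (Fin d) → ℝ) (x : EuclideanSpace ℝ (Fin d)) : ℝ :=
  (∫ y, Real.exp (-‖y‖ ^ 2 / 2) * dunklWeight Rp k y)⁻¹ * dunklWeight Rp k x

end

/-! Everything rests on showing that an entire `F` of exponential type whose restriction to `ℝ^d`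
lies in `L^{p,w}` is bounded on `ℝ^d`. The weights matter only through `IsBoundedBelowOff`: they are
bounded below outside any δ-neighbourhood of finitely many hyperplanes through the origin.

Fix a direction `u` transverse to all the hyperplanes. For small δ, every line parallel to `u` meets
the δ-neighbourhood in a set of small measure. In one variable, a function of exponential type
cannot hide on a set of small measure: `exists_kernel_enorm_rpow_le` bounds `|G 0|^p` by an integral
of `|G|^p` against an integrable kernel over the good set alone. Applying this on each line and
integrating over all base points (Tonelli, translation invariance) gives unweighted integrability,
`lintegral_enorm_rpow_lt_top`.

The one-variable estimate applied coordinate by coordinate then bounds `F` on `ℝ^d`. Finally, on the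
complex line `ζ ↦ x + ζ y` with `x`, `y` real, Phragmén–Lindelöf gives a bound involving only the
supremum over `ℝ^d`, not the constants `c_ε`; taking `ζ = i` and ε → 0 yields the estimate in `Im
z`. The reverse inclusions compare `|Im z|` with `|z|`. -/

section OneVariable

open Complex Set Filter Topology

/-- `G` is an entire function with `‖G z‖ ≤ C * exp (A * ‖z‖)` for some constant `C`. -/
def IsExpType (A : ℝ) (G : ℂ → ℂ) : Prop :=
  Differentiable ℂ G ∧ ∃ C : ℝ, ∀ z, ‖G z‖ ≤ C * Real.exp (A * ‖z‖)

theorem IsExpType.exists_nonneg {A : ℝ} {G : ℂ → ℂ} (h : IsExpType A G) :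
    ∃ C : ℝ, 0 ≤ C ∧ ∀ z, ‖G z‖ ≤ C * Real.exp (A * ‖z‖) := by
  obtain ⟨C, hC⟩ := h.2
  refine ⟨C, ?_, hC⟩
  simpa using (norm_nonneg _).trans (hC 0)

theorem IsExpType.comp_neg {A : ℝ} {G : ℂ → ℂ} (h : IsExpType A G) :
    IsExpType A fun z => G (-z) := by
  obtain ⟨C, hC⟩ := h.2
  exact ⟨h.1.comp differentiable_neg, C, fun z => by simpa using hC (-z)⟩

theorem IsExpType.mul {A B : ℝ} {G H : ℂ → ℂ} (hG : IsExpType A G) (hH : IsExpType B H) :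
    IsExpType (A + B) fun z => G z * H z := by
  obtain ⟨C, hC0, hC⟩ := hG.exists_nonneg
  obtain ⟨D, hD0, hD⟩ := hH.exists_nonneg
  refine ⟨hG.1.mul hH.1, C * D, fun z => ?_⟩
  rw [norm_mul, add_mul, Real.exp_add, mul_mul_mul_comm]
  exact mul_le_mul (hC z) (hD z) (norm_nonneg _) (by positivity)

theorem IsExpType.pow {A : ℝ} {G : ℂ → ℂ} (hG : IsExpType A G) (n : ℕ) :
    IsExpType (n * A) fun z => G z ^ n := by
  induction n with
  | zero => exact ⟨by simp, 1, by simp⟩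
  | succ n ih =>
    have := ih.mul hG
    simp only [pow_succ, Nat.cast_add, Nat.cast_one, add_mul, one_mul]
    exact this

theorem differentiable_conj_comp_conj {G : ℂ → ℂ} (h : Differentiable ℂ G) :
    Differentiable ℂ fun z => (starRingEnd ℂ) (G ((starRingEnd ℂ) z)) := fun z =>
  DifferentiableAt.conj_conj (x := (starRingEnd ℂ) z) (h _) |> fun h' => by
    simpa [Function.comp_def] using h'

/-! ### Phragmén–Lindelöf estimates -/

/-- The exponent of an intermediate weight between `exp u` (small `R`) and `1` (large `R`). -/
noncomputable def growthExponent (R u : ℝ) : ℝ := u - R + R ^ 2 / (u + R)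

theorem growthExponent_eq {R u : ℝ} (hR : 0 < R) (hu : 0 ≤ u) :
    growthExponent R u = u ^ 2 / (u + R) := by
  have : u + R ≠ 0 := by positivity
  unfold growthExponent
  field_simp
  ring

theorem growthExponent_nonneg {R u : ℝ} (hR : 0 < R) (hu : 0 ≤ u) : 0 ≤ growthExponent R u := by
  rw [growthExponent_eq hR hu]; positivity

theorem sub_le_growthExponent {R u : ℝ} (hR : 0 < R) (hu : 0 ≤ u) : u - R ≤ growthExponent R u := by
  have : 0 ≤ R ^ 2 / (u + R) := by positivity
  unfold growthExponent; linarith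

theorem growthExponent_le_add {R u v : ℝ} (hR : 0 < R) (hu : 0 ≤ u) (hv : 0 ≤ v) :
    growthExponent R u ≤ growthExponent R v + |u - v| := by
  have h1 : 0 < u + R := by positivity
  have h2 : 0 < v + R := by positivity
  have key : growthExponent R u - growthExponent R v
      = (u - v) * (1 - (R / (u + R)) * (R / (v + R))) := by
    unfold growthExponent
    field_simp
    ring
  have h3 : R / (u + R) ≤ 1 := by rw [div_le_one h1]; linarith
  have h4 : R / (v + R) ≤ 1 := by rw [div_le_one h2]; linarith
  have h5 : 0 ≤ R / (u + R) := by positivity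
  have h6 : 0 ≤ R / (v + R) := by positivity
  have h7 := mul_le_one₀ h3 h6 h4
  have h8 := mul_nonneg h5 h6
  have : (u - v) * (1 - (R / (u + R)) * (R / (v + R))) ≤ |u - v| * 1 := by
    refine (mul_le_mul_of_nonneg_right (le_abs_self _) (by linarith)).trans ?_
    exact mul_le_mul_of_nonneg_left (by linarith) (abs_nonneg _)
  linarith

theorem tendsto_growthExponent {u : ℝ} (hu : 0 ≤ u) :
    Tendsto (fun R => growthExponent R u) atTop (𝓝 0) := by
  have h : Tendsto (fun R : ℝ => u ^ 2 / (u + R)) atTop (𝓝 0) :=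
    tendsto_const_nhds.div_atTop (tendsto_atTop_add_const_left _ _ tendsto_id)
  refine h.congr' ?_
  filter_upwards [eventually_gt_atTop 0] with R hR
  rw [growthExponent_eq hR hu]

/-- Phragmén–Lindelöf estimate in the first quadrant against the weight given by
`growthExponent`. -/
theorem norm_le_of_quadrant {A C M R : ℝ} {G : ℂ → ℂ} (hA : 0 ≤ A) (hR : 0 < R)
    (hG : Differentiable ℂ G) (hC : ∀ z, ‖G z‖ ≤ C * Real.exp (A * ‖z‖)) (hCM : C ≤ M)
    (hM : ∀ x : ℝ, 0 ≤ x → ‖G x‖ ≤ M * Real.exp (A * growthExponent R x))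
    {z : ℂ} (hre : 0 ≤ z.re) (him : 0 ≤ z.im) :
    ‖G z‖ ≤ M * Real.exp (2 * A * z.im + A * growthExponent R z.re) := by
  have hC0 : 0 ≤ C := by simpa using (norm_nonneg _).trans (hC 0)
  -- The weight exponent is continued holomorphically off the real axis; the extra term `2 * A * I *
  -- z` supplies the decay needed on the imaginary axis. The order of growth 1 is below the critical
  -- order 2 of a quadrant.
  set H : ℂ → ℂ := fun z =>
    G z * cexp (-A * (z - R + R ^ 2 / (z + R)) + 2 * A * I * z) with hH
  have hden : ∀ w : ℂ, 0 ≤ w.re → w + R ≠ 0 := fun w hw h => by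
    have := congrArg Complex.re h
    simp at this; linarith
  have hquot : ∀ w : ℂ, ((R : ℂ) ^ 2 / (w + R)).re
      = R ^ 2 * (w.re + R) / ((w.re + R) ^ 2 + w.im ^ 2) := fun w => by
    rw [Complex.div_re]
    simp [Complex.normSq_apply, sq]
  have hnorm : ∀ w : ℂ, ‖H w‖ = ‖G w‖ * Real.exp (-A * (w.re - R +
      R ^ 2 * (w.re + R) / ((w.re + R) ^ 2 + w.im ^ 2)) - 2 * A * w.im) := fun w => by
    simp only [hH, norm_mul, Complex.norm_exp]
    congr 2
    have : (-(A : ℂ) * (w - R + R ^ 2 / (w + R)) + 2 * A * I * w)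
      = ((-A : ℝ) : ℂ) * (w - R + R ^ 2 / (w + R)) + ((2 * A : ℝ) : ℂ) * (I * w) := by
      push_cast; ring
    rw [this, Complex.add_re, Complex.re_ofReal_mul, Complex.re_ofReal_mul, Complex.add_re, hquot]
    simp
    ring
  have hdiff : DiffContOnCl ℂ H (Ioi 0 ×ℂ Ioi 0) := by
    refine DifferentiableOn.diffContOnCl ?_
    intro w hw
    have hw' : 0 ≤ w.re := by
      have : closure (Ioi (0 : ℝ) ×ℂ Ioi (0 : ℝ)) ⊆ {w : ℂ | 0 ≤ w.re} :=
        closure_minimal (fun w hw => le_of_lt (show 0 < w.re from hw.1)) (isClosed_le continuous_const continuous_re)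
      exact this hw
    refine DifferentiableAt.differentiableWithinAt ?_
    have := hden w hw'
    have h1 := hG w
    simp only [hH]
    fun_prop (disch := assumption)
  have hbound : ∀ w : ℂ, 0 ≤ w.re → 0 ≤ w.im →
      ‖H w‖ ≤ (C * Real.exp (A * R)) * Real.exp (A * ‖w‖) := fun w h1 h2 => by
    rw [hnorm]
    calc _ ≤ (C * Real.exp (A * ‖w‖)) * Real.exp (A * R) := by
          refine mul_le_mul (hC w) ?_ (Real.exp_nonneg _) (by positivity)
          rw [Real.exp_le_exp]
          have h3 : 0 ≤ R ^ 2 * (w.re + R) / ((w.re + R) ^ 2 + w.im ^ 2) := by positivity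
          have h4 := mul_nonneg hA h3
          have h5 := mul_nonneg hA h1
          have h6 := mul_nonneg hA h2
          nlinarith
      _ = _ := by ring
  have hmain : ‖H z‖ ≤ M := by
    refine PhragmenLindelof.quadrant_I hdiff ⟨1, by norm_num, A, ?_⟩ (fun x hx => ?_)
      (fun y hy => ?_) hre him
    · refine Asymptotics.IsBigO.of_bound (C * Real.exp (A * R)) ?_
      refine eventually_inf_principal.2 (Eventually.of_forall fun w hw => ?_)
      simpa using hbound w (le_of_lt hw.1) (le_of_lt hw.2)
    · rw [hnorm]
      have hx' : x + R ≠ 0 := by positivity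
      have : -A * ((x : ℂ).re - R + R ^ 2 * ((x : ℂ).re + R) / (((x : ℂ).re + R) ^ 2
          + (x : ℂ).im ^ 2)) - 2 * A * (x : ℂ).im = -(A * growthExponent R x) := by
        simp only [ofReal_re, ofReal_im, growthExponent]
        field_simp
        ring
      rw [this, Real.exp_neg, ← div_eq_mul_inv, div_le_iff₀ (Real.exp_pos _)]
      exact hM x hx
    · rw [hnorm]
      refine le_trans ?_ hCM
      have h1 : ‖G (y * I)‖ ≤ C * Real.exp (A * y) := by
        simpa [abs_of_nonneg hy] using hC (y * I)
      -- On the imaginary axis the weight costs at most `exp (A * y)` and `G` at most `C * exp (A *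
      -- y)`; the factor `exp (-2 * A * y)` absorbs both.
      have h2 : R - R ^ 2 * R / (R ^ 2 + y ^ 2) ≤ y := by
        have : 0 < R ^ 2 + y ^ 2 := by positivity
        rw [sub_le_iff_le_add, ← sub_le_iff_le_add', le_div_iff₀ this]
        have : 0 ≤ y * (y - R) ^ 2 + y * R * y := by positivity
        nlinarith [mul_nonneg hy hR.le]
      calc _ ≤ (C * Real.exp (A * y)) * Real.exp (-(A * y)) := by
            refine mul_le_mul h1 ?_ (Real.exp_nonneg _) (by positivity)
            rw [Real.exp_le_exp]
            simp
            nlinarith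
        _ = C := by rw [mul_assoc, ← Real.exp_add]; simp
  rw [hnorm] at hmain
  have h0 : 0 ≤ M := hC0.trans hCM
  have hle : z.re - R + R ^ 2 * (z.re + R) / ((z.re + R) ^ 2 + z.im ^ 2)
      ≤ growthExponent R z.re := by
    have h1 : 0 < z.re + R := by positivity
    refine add_le_add_right ?_ _
    rw [div_le_div_iff₀ (by positivity) h1]
    have : 0 ≤ R ^ 2 * z.im ^ 2 := by positivity
    nlinarith
  rw [← le_div_iff₀ (Real.exp_pos _), div_eq_mul_inv, ← Real.exp_neg] at hmain
  refine hmain.trans (mul_le_mul_of_nonneg_left ?_ h0)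
  rw [Real.exp_le_exp]
  have := mul_le_mul_of_nonneg_left hle hA
  linarith

theorem norm_le_of_growthExponent {A C M R : ℝ} {G : ℂ → ℂ} (hA : 0 ≤ A) (hR : 0 < R)
    (hG : Differentiable ℂ G) (hC : ∀ z, ‖G z‖ ≤ C * Real.exp (A * ‖z‖)) (hCM : C ≤ M)
    (hM : ∀ x : ℝ, ‖G x‖ ≤ M * Real.exp (A * growthExponent R |x|)) (z : ℂ) :
    ‖G z‖ ≤ M * Real.exp (2 * A * |z.im| + A * growthExponent R |z.re|) := by
  have upper : ∀ G : ℂ → ℂ, Differentiable ℂ G → (∀ z, ‖G z‖ ≤ C * Real.exp (A * ‖z‖)) →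
      (∀ x : ℝ, ‖G x‖ ≤ M * Real.exp (A * growthExponent R |x|)) → ∀ z : ℂ, 0 ≤ z.re →
      ‖G z‖ ≤ M * Real.exp (2 * A * |z.im| + A * growthExponent R |z.re|) := by
    intro G hG hC hM z hz
    rcases le_total 0 z.im with h | h
    · rw [abs_of_nonneg hz, abs_of_nonneg h]
      exact norm_le_of_quadrant hA hR hG hC hCM
        (fun x hx => by simpa [abs_of_nonneg hx] using hM x) hz h
    · have := norm_le_of_quadrant (z := (starRingEnd ℂ) z) hA hR (differentiable_conj_comp_conj hG)
        (fun w => by simpa using hC ((starRingEnd ℂ) w)) hCM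
        (fun x hx => by simpa [abs_of_nonneg hx] using hM x) (by simpa using hz) (by simpa using h)
      simpa [abs_of_nonneg hz, abs_of_nonpos h] using this
  rcases le_total 0 z.re with h | h
  · exact upper G hG hC hM z h
  · simpa using upper (fun w => G (-w)) (hG.comp differentiable_neg)
      (fun w => by simpa using hC (-w)) (fun x => by simpa using hM (-x)) (-z) (by simpa using h)

/-- An entire function of exponential type `τ` that is bounded by `M` on the real line satisfies
`‖G z‖ ≤ M * exp (τ * |Im z|)`. -/
theorem norm_le_mul_exp_abs_im {A M : ℝ} {G : ℂ → ℂ} (hG : IsExpType A G)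
    (hM : ∀ x : ℝ, ‖G x‖ ≤ M) (z : ℂ) : ‖G z‖ ≤ M * Real.exp (A * |z.im|) := by
  have upper : ∀ G : ℂ → ℂ, IsExpType A G → (∀ x : ℝ, ‖G x‖ ≤ M) → ∀ z : ℂ, 0 ≤ z.im →
      ‖G z‖ ≤ M * Real.exp (A * |z.im|) := by
    intro G hG hM z hz
    obtain ⟨C, hC0, hC⟩ := hG.exists_nonneg
    -- The rotation carries the upper half-plane to the right one: `H` is bounded by `M` on the
    -- imaginary axis and merely bounded on the positive real axis.
    set H : ℂ → ℂ := fun w => G (w * I) * cexp (-(A * w)) with hH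
    have hnorm : ∀ w : ℂ, ‖H w‖ = ‖G (w * I)‖ * Real.exp (-(A * w.re)) := fun w => by
      simp [hH, Complex.norm_exp]
    have hbound : ∀ w : ℂ, ‖H w‖ ≤ C * Real.exp (A * ‖w‖) * Real.exp (-(A * w.re)) := fun w => by
      rw [hnorm]
      gcongr
      simpa using hC (w * I)
    have hd : Differentiable ℂ H := by
      have := hG.1
      exact (this.comp (differentiable_id.mul_const I)).mul (by fun_prop)
    have := PhragmenLindelof.right_half_plane_of_bounded_on_real (f := H) (C := M)
      (z := z * (-I)) hd.diffContOnCl ⟨1, by norm_num, |A| + |A|, ?_⟩ ?_ (fun y => ?_) (by simpa)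
    · rw [hnorm] at this
      have h2 : z * -I * I = z := by rw [mul_assoc]; simp
      rw [h2, Real.exp_neg, ← div_eq_mul_inv, div_le_iff₀ (Real.exp_pos _)] at this
      simpa [abs_of_nonneg hz] using this
    · refine Asymptotics.IsBigO.of_bound C (Eventually.of_forall fun w => ?_)
      refine (hbound w).trans ?_
      rw [mul_assoc, ← Real.exp_add, Real.rpow_one, Real.norm_of_nonneg (Real.exp_nonneg _)]
      gcongr
      have h1 : A * ‖w‖ ≤ |A| * ‖w‖ := by gcongr; exact le_abs_self A
      have h2 : -(A * w.re) ≤ |A| * ‖w‖ := by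
        refine (neg_le_abs _).trans ?_
        rw [abs_mul]
        gcongr
        exact Complex.abs_re_le_norm w
      linarith
    · refine isBoundedUnder_of_eventually_le (a := C) ?_
      filter_upwards [eventually_ge_atTop 0] with x hx
      refine (hbound x).trans ?_
      rw [mul_assoc, ← Real.exp_add]
      simp [abs_of_nonneg hx]
    · rw [hnorm]
      have : (y : ℂ) * I * I = ((-y : ℝ) : ℂ) := by rw [mul_assoc]; simp
      rw [this]
      simpa using hM (-y)
  rcases le_total 0 z.im with h | h
  · exact upper G hG hM z h
  · simpa using upper _ hG.comp_neg (fun x => by simpa using hM (-x)) (-z) (by simpa using h)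

/-! ### Bounds from a dense set of points -/

/-- Cauchy's estimate on unit circles centred in the unit ball, followed by the mean value
inequality. -/
theorem norm_sub_le_of_closedBall {G : ℂ → ℂ} (hG : Differentiable ℂ G) {B x t : ℝ}
    (hB : ∀ z ∈ Metric.closedBall (x : ℂ) 2, ‖G z‖ ≤ B) (ht : |x - t| ≤ 1) :
    ‖G x - G t‖ ≤ B * |x - t| := by
  have hder : ∀ w ∈ Metric.closedBall (x : ℂ) 1, ‖deriv G w‖ ≤ B := fun w hw => by
    have := Complex.norm_deriv_le_of_forall_mem_sphere_norm_le (c := w) (R := 1) (C := B) one_pos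
      hG.diffContOnCl (fun z hz => hB z ?_)
    · simpa using this
    · rw [Metric.mem_closedBall] at *
      have := dist_triangle z w x
      rw [Metric.mem_sphere] at hz
      linarith
  have hd : dist (t : ℂ) x = |x - t| := by
    rw [Complex.dist_eq, ← Complex.ofReal_sub, Complex.norm_real, Real.norm_eq_abs, abs_sub_comm]
  have := (convex_closedBall (x : ℂ) 1).norm_image_sub_le_of_norm_deriv_le
    (fun w _ => hG w) hder (x := (t : ℂ)) (y := x) (by rw [Metric.mem_closedBall, hd]; exact ht)
    (by simp)
  rwa [← Complex.dist_eq (x : ℂ) t, dist_comm, hd] at this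

/-- Absorption: take `M` to be the supremum, which must be finite for `M / 2` to be moved to the
left. The lower threshold `C` allows an implication valid only for large `M`. -/
theorem le_max_of_forall_le_imp {ι : Type*} {g : ι → ℝ} {B C S : ℝ} (hB : ∀ x, g x ≤ B)
    (h : ∀ M, C ≤ M → (∀ x, g x ≤ M) → ∀ x, g x ≤ S + M / 2) (x : ι) : g x ≤ max C (2 * S) := by
  have : Nonempty ι := ⟨x⟩
  have hbdd : BddAbove (range g) := ⟨B, by rintro _ ⟨y, rfl⟩; exact hB y⟩
  have hle : ∀ y, g y ≤ iSup g := fun y => le_ciSup hbdd y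
  refine (hle x).trans ?_
  by_contra! hlt
  have h1 : iSup g ≤ S + iSup g / 2 :=
    ciSup_le (h _ ((le_max_left _ _).trans hlt.le) hle)
  have h2 := (le_max_right C (2 * S)).trans_lt hlt
  linarith

/-- An entire function of exponential type that is bounded by `S` on a sufficiently dense subset
of the real line is bounded by `2 * S` on the real line. -/
theorem norm_le_two_mul_of_dense {A S a : ℝ} {G : ℂ → ℂ} (hA : 0 ≤ A) (hG : IsExpType A G)
    (ha1 : a ≤ 1) (ha : a * Real.exp (6 * A) ≤ 1 / 2)
    (hS : ∀ x : ℝ, ∃ t : ℝ, |x - t| ≤ a ∧ ‖G t‖ ≤ S) (x : ℝ) : ‖G x‖ ≤ 2 * S := by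
  have hS0 : 0 ≤ S := by
    obtain ⟨t, -, h⟩ := hS 0
    exact (norm_nonneg _).trans h
  obtain ⟨C, hC0, hC⟩ := hG.exists_nonneg
  -- Boundedness of `G` on the line is not yet known, so absorption is first run against a weight
  -- that dominates `exp (A * (|x| - R))` and makes the supremum finite. The resulting bound does
  -- not depend on `R`, and letting `R → ∞` removes the weight.
  have weighted : ∀ R : ℝ, 0 < R → ∀ x : ℝ,
      ‖G x‖ * Real.exp (-(A * growthExponent R |x|)) ≤ max C (2 * S) := by
    intro R hR
    refine le_max_of_forall_le_imp (B := C * Real.exp (A * R)) (fun x => ?_) fun M hCM hM x => ?_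
    · calc _ ≤ (C * Real.exp (A * |x|)) * Real.exp (-(A * growthExponent R |x|)) := by
            gcongr
            simpa using hC x
        _ ≤ _ := by
            rw [mul_assoc, ← Real.exp_add]
            gcongr
            have := mul_le_mul_of_nonneg_left (sub_le_growthExponent hR (abs_nonneg x)) hA
            linarith
    · have hM0 : 0 ≤ M := hC0.trans hCM
      have hM' : ∀ x : ℝ, ‖G x‖ ≤ M * Real.exp (A * growthExponent R |x|) := fun x => by
        have := hM x
        rwa [Real.exp_neg, ← div_eq_mul_inv, div_le_iff₀ (Real.exp_pos _)] at this
      have hstrip := norm_le_of_growthExponent hA hR hG.1 hC hCM hM'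
      set W := Real.exp (A * growthExponent R |x|) with hW
      -- On a ball of radius 2 the imaginary part contributes `4 * A` and the 1-Lipschitz weight
      -- exponent `2 * A`, whence `6 * A`.
      have hball : ∀ z ∈ Metric.closedBall (x : ℂ) 2, ‖G z‖ ≤ M * Real.exp (6 * A) * W := by
        intro z hz
        rw [Metric.mem_closedBall, Complex.dist_eq] at hz
        refine (hstrip z).trans ?_
        rw [hW, mul_assoc M (Real.exp (6 * A)), ← Real.exp_add]
        refine mul_le_mul_of_nonneg_left (Real.exp_le_exp.2 ?_) hM0
        have h1 : |z.im| ≤ 2 := by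
          simpa using (Complex.abs_im_le_norm (z - x)).trans hz
        have h2 : abs (|z.re| - |x|) ≤ 2 := by
          refine (abs_abs_sub_abs_le_abs_sub z.re x).trans ?_
          simpa using (Complex.abs_re_le_norm (z - x)).trans hz
        have h3 := growthExponent_le_add hR (abs_nonneg z.re) (abs_nonneg x)
        have h4 := mul_le_mul_of_nonneg_left (h3.trans (add_le_add_right h2 _)) hA
        have h5 := mul_le_mul_of_nonneg_left h1 hA
        linarith
      obtain ⟨t, ht, htS⟩ := hS x
      have h1 := norm_sub_le_of_closedBall hG.1 hball (ht.trans ha1)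
      have hW1 : 1 ≤ W :=
        Real.one_le_exp (mul_nonneg hA (growthExponent_nonneg hR (abs_nonneg x)))
      have h2 : M * Real.exp (6 * A) * W * |x - t| ≤ M / 2 * W := by
        have : Real.exp (6 * A) * |x - t| ≤ 1 / 2 := by
          refine le_trans ?_ ha
          rw [mul_comm]; gcongr
        calc _ = (M * W) * (Real.exp (6 * A) * |x - t|) := by ring
          _ ≤ (M * W) * (1 / 2) := by gcongr
          _ = _ := by ring
      rw [Real.exp_neg, ← div_eq_mul_inv, div_le_iff₀ (Real.exp_pos _), ← hW]
      have h3 : ‖G x‖ ≤ ‖G t‖ + ‖G x - G t‖ := norm_le_norm_add_norm_sub' _ _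
      nlinarith
  have hbdd : ∀ x : ℝ, ‖G x‖ ≤ max C (2 * S) := fun x => by
    have h1 : Tendsto (fun R : ℝ => ‖G x‖ * Real.exp (-(A * growthExponent R |x|))) atTop
        (𝓝 (‖G x‖ * Real.exp (-(A * 0)))) :=
      ((Real.continuous_exp.tendsto _).comp
        ((tendsto_growthExponent (abs_nonneg x)).const_mul A).neg).const_mul _
    refine le_of_tendsto (by simpa using h1) ?_
    filter_upwards [eventually_gt_atTop 0] with R hR using weighted R hR x
  -- Now that `G` is known to be bounded, a second absorption without weight removes the dependence
  -- on `C`.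
  have hfin := le_max_of_forall_le_imp (C := 0) (S := S) hbdd fun M hM0 hM x => ?_
  · refine (hfin x).trans ?_
    simp [hS0]
  · obtain ⟨t, ht, htS⟩ := hS x
    have h1 := norm_sub_le_of_closedBall (B := M * Real.exp (6 * A)) hG.1 (fun z hz => ?_)
      (ht.trans ha1)
    · have h2 : M * Real.exp (6 * A) * |x - t| ≤ M * (1 / 2) := by
        rw [mul_assoc]
        gcongr
        refine le_trans ?_ ha
        rw [mul_comm]; gcongr
      have h3 : ‖G x‖ ≤ ‖G t‖ + ‖G x - G t‖ := norm_le_norm_add_norm_sub' _ _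
      linarith
    · refine (norm_le_mul_exp_abs_im hG hM z).trans
        (mul_le_mul_of_nonneg_left (Real.exp_le_exp.2 ?_) hM0)
      rw [Metric.mem_closedBall, Complex.dist_eq] at hz
      have h1 : |z.im| ≤ 2 := by
        simpa using (Complex.abs_im_le_norm (z - x)).trans hz
      nlinarith

end OneVariable

/-! ### Integral estimates in one variable -/

section OneVariableIntegral

open Complex Set Filter Topology
open scoped ENNReal NNReal

/-- Every interval of length `b` keeps at least half its measure inside `E`, hence contains a point
where `‖G‖ₑ ^ p` is at most its mean over that part. These points are dense enough for
`norm_le_two_mul_of_dense`. The constants depend only on `A` and `p`. -/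
theorem exists_enorm_rpow_le_lintegral {A p : ℝ} (hA : 0 ≤ A) (hp : 0 < p) :
    ∃ a : ℝ, 0 < a ∧ ∃ K : ℝ≥0∞, K ≠ ∞ ∧ ∀ E : Set ℝ, MeasurableSet E →
      volume Eᶜ ≤ ENNReal.ofReal a → ∀ G : ℂ → ℂ, IsExpType A G → ∀ x : ℝ,
        ‖G x‖ₑ ^ p ≤ K * ∫⁻ t in E, ‖G t‖ₑ ^ p := by
  set b : ℝ := Real.exp (-(6 * A)) / 2 with hb
  have hb0 : 0 < b := by positivity
  have hb1 : b ≤ 1 := by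
    have : Real.exp (-(6 * A)) ≤ 1 := Real.exp_le_one_iff.2 (by linarith)
    linarith
  have hbA : b * Real.exp (6 * A) ≤ 1 / 2 := by
    rw [hb, div_mul_eq_mul_div, ← Real.exp_add]; simp
  refine ⟨b / 2, by positivity, 2 ^ p * (ENNReal.ofReal (b / 2))⁻¹, ?_, ?_⟩
  · refine ENNReal.mul_ne_top (ENNReal.rpow_ne_top_of_nonneg hp.le (by simp)) ?_
    simpa using hb0
  intro E hE hEc G hG x
  set J := ∫⁻ t in E, ‖G t‖ₑ ^ p with hJ
  have hb2 : ENNReal.ofReal (b / 2) ≠ 0 := by simpa using hb0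
  rcases eq_or_ne J ∞ with hJt | hJt
  · rw [hJt, ENNReal.mul_top]
    · exact le_top
    · exact mul_ne_zero (ENNReal.rpow_pos (by simp) (by simp)).ne' (ENNReal.inv_ne_zero.2 (by simp))
  have hKJ : (ENNReal.ofReal (b / 2))⁻¹ * J ≠ ∞ :=
    ENNReal.mul_ne_top (ENNReal.inv_ne_top.2 hb2) hJt
  have hSt : ((ENNReal.ofReal (b / 2))⁻¹ * J) ^ (1 / p) ≠ ∞ :=
    ENNReal.rpow_ne_top_of_nonneg (by positivity) hKJ
  have hmeas : Measurable fun t : ℝ => ‖G t‖ₑ ^ p :=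
    ((hG.1.continuous.comp continuous_ofReal).enorm.measurable).pow_const p
  have key := norm_le_two_mul_of_dense hA hG hb1 hbA
    (S := (((ENNReal.ofReal (b / 2))⁻¹ * J) ^ (1 / p)).toReal) (fun y => ?_) x
  · have h1 : ‖G x‖ₑ ≤ 2 * ((ENNReal.ofReal (b / 2))⁻¹ * J) ^ (1 / p) := by
      rw [← ofReal_norm, ← ENNReal.ofReal_toReal hSt]
      refine (ENNReal.ofReal_le_ofReal key).trans_eq ?_
      rw [ENNReal.ofReal_mul (by norm_num)]; simp
    calc ‖G x‖ₑ ^ p ≤ (2 * ((ENNReal.ofReal (b / 2))⁻¹ * J) ^ (1 / p)) ^ p := by gcongr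
      _ = 2 ^ p * (ENNReal.ofReal (b / 2))⁻¹ * J := by
        rw [ENNReal.mul_rpow_of_nonneg _ _ hp.le, ← ENNReal.rpow_mul, one_div,
          inv_mul_cancel₀ hp.ne', ENNReal.rpow_one, mul_assoc]
  · have hvol : ENNReal.ofReal (b / 2) ≤ volume (Icc y (y + b) ∩ E) := by
      have h1 : volume (Icc y (y + b)) ≤ volume (Icc y (y + b) ∩ E) + volume Eᶜ := by
        refine (measure_mono fun t ht => ?_).trans (measure_union_le _ _)
        by_cases h : t ∈ E
        · exact Or.inl ⟨ht, h⟩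
        · exact Or.inr h
      have h2 : volume (Icc y (y + b)) = ENNReal.ofReal (b / 2) + ENNReal.ofReal (b / 2) := by
        rw [Real.volume_Icc, ← ENNReal.ofReal_add (by positivity) (by positivity)]
        congr 1; ring
      rw [h2] at h1
      exact ENNReal.le_of_add_le_add_right (by simp) (h1.trans (add_le_add_right hEc _))
    have hfin : volume (Icc y (y + b) ∩ E) ≠ ∞ :=
      measure_ne_top_of_subset inter_subset_left (by simp)
    obtain ⟨t, ht, hle⟩ := exists_le_setLAverage (μ := volume) (s := Icc y (y + b) ∩ E)
      (f := fun t : ℝ => ‖G t‖ₑ ^ p) ((pos_iff_ne_zero.2 hb2).trans_le hvol).ne' hfin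
      hmeas.aemeasurable
    refine ⟨t, ?_, ?_⟩
    · rw [abs_sub_comm, abs_of_nonneg] <;> linarith [ht.1.1, ht.1.2]
    · rw [setLAverage_eq, ENNReal.div_eq_inv_mul] at hle
      have h1 : ‖G t‖ₑ ^ p ≤ (ENNReal.ofReal (b / 2))⁻¹ * J :=
        hle.trans (mul_le_mul' (ENNReal.inv_le_inv.2 hvol)
          (lintegral_mono_set inter_subset_right))
      have h2 : ‖G t‖ₑ ≤ ((ENNReal.ofReal (b / 2))⁻¹ * J) ^ (1 / p) := by
        rwa [one_div, ENNReal.le_rpow_inv_iff hp]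
      rw [← toReal_enorm]
      exact ENNReal.toReal_mono hSt h2

/-- An entire function of exponential type equal to `1` at the origin and decaying like `1 / |x|`
on the real line. -/
theorem exists_isExpType_decay : ∃ H : ℂ → ℂ, IsExpType 1 H ∧ H 0 = 1 ∧
    ∀ x : ℝ, ‖H x‖ ^ 2 ≤ 2 / (1 + x ^ 2) := by
  have hd : Differentiable ℂ (dslope Complex.sin 0) := by
    rw [← differentiableOn_univ, Complex.differentiableOn_dslope univ_mem]
    exact Complex.differentiable_sin.differentiableOn
  have h0 : dslope Complex.sin 0 0 = 1 := by simp [dslope_same]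
  have hne : ∀ z : ℂ, z ≠ 0 → dslope Complex.sin 0 z = Complex.sin z / z := fun z hz => by
    rw [dslope_of_ne _ hz, slope_def_field]; simp
  have hsin : ∀ z : ℂ, ‖Complex.sin z‖ ≤ Real.exp ‖z‖ := fun z => by
    rw [Complex.sin, norm_div, norm_mul]
    have h1 : ‖cexp (-z * I)‖ ≤ Real.exp ‖z‖ := by
      simpa using Complex.norm_exp_le_exp_norm (-z * I)
    have h2 : ‖cexp (z * I)‖ ≤ Real.exp ‖z‖ := by
      simpa using Complex.norm_exp_le_exp_norm (z * I)
    have h3 := norm_sub_le (cexp (-z * I)) (cexp (z * I))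
    simp only [Complex.norm_I, mul_one, Complex.norm_ofNat]
    linarith
  -- The function is `sin z / z` with its singularity removed.
  refine ⟨dslope Complex.sin 0, ⟨hd, ?_⟩, h0, fun x => ?_⟩
  · obtain ⟨C, hC⟩ := (isCompact_closedBall (0 : ℂ) 1).exists_bound_of_continuousOn
      hd.continuous.continuousOn
    refine ⟨max C 1, fun z => ?_⟩
    rw [one_mul]
    rcases le_total ‖z‖ 1 with h | h
    · refine (hC z (by simpa using h)).trans ((le_max_left C 1).trans ?_)
      exact le_mul_of_one_le_right (by positivity) (Real.one_le_exp (norm_nonneg _))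
    · have hz : z ≠ 0 := by rintro rfl; simp at h; linarith
      rw [hne z hz, norm_div, div_le_iff₀ (norm_pos_iff.2 hz)]
      calc _ ≤ 1 * Real.exp ‖z‖ * 1 := by simpa using hsin z
        _ ≤ _ := by gcongr; exact le_max_right _ _
  · rcases eq_or_ne x 0 with rfl | hx
    · simp
    · rw [hne x (by exact_mod_cast hx), ← Complex.ofReal_sin, ← Complex.ofReal_div,
        Complex.norm_real, Real.norm_eq_abs, sq_abs, div_pow, div_le_div_iff₀ (by positivity)
        (by positivity)]
      have h1 : Real.sin x ^ 2 ≤ 1 := Real.sin_sq_le_one x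
      have h2 : Real.sin x ^ 2 ≤ x ^ 2 := by
        rw [sq_le_sq]; exact Real.abs_sin_le_abs
      nlinarith [sq_nonneg x]

/-- A pointwise estimate with an integrable kernel, for entire functions of exponential type and
sets with small complement. -/
theorem exists_kernel_enorm_rpow_le {A p : ℝ} (hA : 0 ≤ A) (hp : 0 < p) :
    ∃ a : ℝ, 0 < a ∧ ∃ k : ℝ → ℝ≥0∞, Measurable k ∧ ∫⁻ t, k t ≠ ∞ ∧ ∀ E : Set ℝ,
      MeasurableSet E → volume Eᶜ ≤ ENNReal.ofReal a → ∀ G : ℂ → ℂ, IsExpType A G →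
        ‖G 0‖ₑ ^ p ≤ ∫⁻ t in E, ‖G t‖ₑ ^ p * k t := by
  obtain ⟨H, hH, hH0, hHd⟩ := exists_isExpType_decay
  -- With `N * p ≥ 1`, the power `‖H ^ (2 * N)‖ ^ p` is at most a multiple of `1 / (1 + t ^ 2)`, so
  -- it is integrable for small `p` too.
  obtain ⟨N, hN⟩ := exists_nat_ge (1 / p)
  have hNp : 1 ≤ N * p := by
    rwa [div_le_iff₀ hp] at hN
  obtain ⟨a, ha, K, hK, h⟩ := exists_enorm_rpow_le_lintegral (A := A + (2 * N : ℕ) * 1) (p := p)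
    (by positivity) hp
  have hm : Measurable fun t : ℝ => ‖H t ^ (2 * N)‖ₑ ^ p :=
    (((hH.1.continuous.comp continuous_ofReal).pow _).enorm.measurable).pow_const p
  refine ⟨a, ha, fun t => K * ‖H t ^ (2 * N)‖ₑ ^ p, hm.const_mul K, ?_, fun E hE hEc G hG => ?_⟩
  · rw [lintegral_const_mul _ hm]
    refine ENNReal.mul_ne_top hK (ne_of_lt ?_)
    have hle : ∀ t : ℝ, ‖H t ^ (2 * N)‖ₑ ^ p
        ≤ ENNReal.ofReal (2 ^ (N * p) * (1 + t ^ 2)⁻¹) := fun t => by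
      rw [← ofReal_norm, ENNReal.ofReal_rpow_of_nonneg (norm_nonneg _) hp.le]
      refine ENNReal.ofReal_le_ofReal ?_
      rw [norm_pow, pow_mul, ← Real.rpow_natCast, ← Real.rpow_mul (by positivity)]
      refine (Real.rpow_le_rpow (by positivity) (hHd t) (by positivity)).trans ?_
      rw [div_eq_mul_inv, Real.mul_rpow (by norm_num) (by positivity)]
      gcongr
      have h1 : (1 + t ^ 2)⁻¹ ≤ 1 := inv_le_one_of_one_le₀ (by nlinarith [sq_nonneg t])
      simpa using Real.rpow_le_rpow_of_exponent_ge (by positivity) h1 hNp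
    refine (lintegral_mono hle).trans_lt ?_
    exact (integrable_inv_one_add_sq.const_mul _).lintegral_lt_top
  -- Multiplying by `H ^ (2 * N)` leaves the value at 0 unchanged and turns the constant `K` into an
  -- integrable kernel.
  · have := h E hE hEc _ (hG.mul (hH.pow (2 * N))) 0
    rw [← lintegral_const_mul' _ _ hK] at this
    rw [Complex.ofReal_zero, hH0, one_pow, mul_one] at this
    refine this.trans_eq (lintegral_congr fun t => ?_)
    rw [enorm_mul, ENNReal.mul_rpow_of_nonneg _ _ hp.le]
    ring

end OneVariableIntegral

/-! ### Slicing by lines in several variables -/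

section SeveralVariables

open Set Filter Topology
open scoped ENNReal

variable {d : ℕ}

theorem realToComplex_apply (x : EuclideanSpace ℝ (Fin d)) (i : Fin d) :
    realToComplex x i = (x i : ℂ) := rfl

theorem imPart_apply (z : EuclideanSpace ℂ (Fin d)) (i : Fin d) : imPart z i = (z i).im := rfl

theorem realToComplex_add_smul (x u : EuclideanSpace ℝ (Fin d)) (t : ℝ) :
    realToComplex (x + t • u) = realToComplex x + (t : ℂ) • realToComplex u := by
  ext i
  simp [realToComplex_apply]

theorem norm_realToComplex (x : EuclideanSpace ℝ (Fin d)) : ‖realToComplex x‖ = ‖x‖ := by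
  simp [EuclideanSpace.norm_eq, realToComplex_apply]

theorem continuous_realToComplex : Continuous (realToComplex (d := d)) := by
  unfold realToComplex
  fun_prop

theorem isExpType_slice {F : EuclideanSpace ℂ (Fin d) → ℂ} (hF : Differentiable ℂ F)
    {N : EuclideanSpace ℂ (Fin d) → ℝ} {C : ℝ} (hC : ∀ z, ‖F z‖ ≤ C * Real.exp (N z))
    {x y : EuclideanSpace ℂ (Fin d)} (hN : ∀ ζ : ℂ, N (x + ζ • y) ≤ N x + ‖ζ‖ * N y) :
    IsExpType (N y) fun ζ => F (x + ζ • y) := by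
  refine ⟨hF.comp (by fun_prop), C * Real.exp (N x), fun ζ => (hC _).trans ?_⟩
  have hC0 : 0 ≤ C :=
    nonneg_of_mul_nonneg_left ((norm_nonneg _).trans (hC 0)) (Real.exp_pos _)
  rw [mul_assoc, ← Real.exp_add]
  gcongr
  rw [mul_comm (N y)]
  exact hN ζ

theorem isExpType_slice_norm {F : EuclideanSpace ℂ (Fin d) → ℂ} (hF : Differentiable ℂ F)
    {A C : ℝ} (hA : 0 ≤ A) (hC : ∀ z, ‖F z‖ ≤ C * Real.exp (A * ‖z‖))
    (x y : EuclideanSpace ℂ (Fin d)) : IsExpType (A * ‖y‖) fun ζ => F (x + ζ • y) := by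
  refine isExpType_slice (N := fun z => A * ‖z‖) hF hC fun ζ => ?_
  have h : ‖x + ζ • y‖ ≤ ‖x‖ + ‖ζ‖ * ‖y‖ := (norm_add_le _ _).trans_eq (by rw [norm_smul])
  have := mul_le_mul_of_nonneg_left h hA
  linarith

/-- The weight `w` is bounded below away from finitely many hyperplanes through the origin. -/
def IsBoundedBelowOff (B : Finset (EuclideanSpace ℝ (Fin d)))
    (w : EuclideanSpace ℝ (Fin d) → ℝ) : Prop :=
  (∀ β ∈ B, β ≠ 0) ∧ ∀ δ : ℝ, 0 < δ → ∃ c : ℝ, 0 < c ∧ ∀ x, (∀ β ∈ B, δ ≤ |inner ℝ β x|) → c ≤ w x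

theorem exists_forall_inner_ne_zero (B : Finset (EuclideanSpace ℝ (Fin d)))
    (hB : ∀ β ∈ B, β ≠ 0) : ∃ u : EuclideanSpace ℝ (Fin d), ∀ β ∈ B, inner ℝ β u ≠ 0 := by
  obtain ⟨f, hf⟩ := Module.exists_dual_forall_apply_ne_zero (K := ℝ)
    (fun β : B => (β : EuclideanSpace ℝ (Fin d))) fun β => hB β β.2
  refine ⟨(InnerProductSpace.toDual ℝ _).symm (LinearMap.toContinuousLinearMap f), fun β hβ => ?_⟩
  rw [real_inner_comm, InnerProductSpace.toDual_symm_apply]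
  exact hf ⟨β, hβ⟩

theorem volume_abs_add_mul_lt_le {b c δ : ℝ} (hc : c ≠ 0) :
    volume {t : ℝ | |b + t * c| < δ} ≤ ENNReal.ofReal (2 * (δ / |c|)) := by
  rw [← Real.volume_ball (-(b / c))]
  refine measure_mono fun t ht => ?_
  rw [mem_ofPred_eq] at ht
  rw [Metric.mem_ball, Real.dist_eq, lt_div_iff₀ (abs_pos.2 hc), ← abs_mul]
  have h : (t - -(b / c)) * c = b + t * c := by
    field_simp
    ring
  rwa [h]

/-- Transversality makes each slab cut the line in an interval whose length is proportional to δ and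
bounded independently of `x`. -/
theorem exists_volume_line_le (B : Finset (EuclideanSpace ℝ (Fin d)))
    {u : EuclideanSpace ℝ (Fin d)} (hu : ∀ β ∈ B, inner ℝ β u ≠ 0) {a : ℝ} (ha : 0 < a) :
    ∃ δ : ℝ, 0 < δ ∧ ∀ x : EuclideanSpace ℝ (Fin d),
      volume {t : ℝ | ∀ β ∈ B, δ ≤ |inner ℝ β (x + t • u)|}ᶜ ≤ ENNReal.ofReal a := by
  set T : ℝ := ∑ β ∈ B, 2 / |inner ℝ β u| with hT
  have hT0 : 0 ≤ T := Finset.sum_nonneg fun β _ => by positivity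
  -- The `+ 1` covers the case of no hyperplanes, where `T = 0`.
  refine ⟨a / (T + 1), by positivity, fun x => ?_⟩
  calc _ ≤ volume (⋃ β ∈ B, {t : ℝ | |inner ℝ β x + t * inner ℝ β u| < a / (T + 1)}) := by
        refine measure_mono fun t ht => ?_
        simp only [mem_compl_iff, mem_ofPred_eq, not_forall, not_le] at ht
        obtain ⟨β, hβ, h⟩ := ht
        simp only [mem_iUnion, mem_ofPred_eq]
        refine ⟨β, hβ, ?_⟩
        rwa [inner_add_right, inner_smul_right] at h
    _ ≤ ∑ β ∈ B, volume {t : ℝ | |inner ℝ β x + t * inner ℝ β u| < a / (T + 1)} :=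
        measure_biUnion_finset_le _ _
    _ ≤ ∑ β ∈ B, ENNReal.ofReal (2 * (a / (T + 1) / |inner ℝ β u|)) :=
        Finset.sum_le_sum fun β hβ => volume_abs_add_mul_lt_le (hu β hβ)
    _ = ENNReal.ofReal (∑ β ∈ B, 2 * (a / (T + 1) / |inner ℝ β u|)) :=
        (ENNReal.ofReal_sum_of_nonneg fun β _ => by positivity).symm
    _ ≤ ENNReal.ofReal a := by
        refine ENNReal.ofReal_le_ofReal ?_
        have : ∑ β ∈ B, 2 * (a / (T + 1) / |inner ℝ β u|) = a / (T + 1) * T := by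
          rw [hT, Finset.mul_sum]
          exact Finset.sum_congr rfl fun β _ => by ring
        rw [this, div_mul_eq_mul_div, div_le_iff₀ (by positivity)]
        nlinarith

theorem lintegral_enorm_rpow_lt_top {p : ℝ} (hp : 0 < p) {F : EuclideanSpace ℂ (Fin d) → ℂ}
    (hF : Differentiable ℂ F) {A C : ℝ} (hA : 0 ≤ A) (hC : ∀ z, ‖F z‖ ≤ C * Real.exp (A * ‖z‖))
    {B : Finset (EuclideanSpace ℝ (Fin d))} {w : EuclideanSpace ℝ (Fin d) → ℝ}
    (hw : IsBoundedBelowOff B w)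
    (hfin : ∫⁻ x, ‖F (realToComplex x)‖ₑ ^ p * ENNReal.ofReal (w x) < ∞) :
    ∫⁻ x, ‖F (realToComplex x)‖ₑ ^ p < ∞ := by
  obtain ⟨u, hu⟩ := exists_forall_inner_ne_zero B hw.1
  obtain ⟨a, ha, k, hkm, hk, hker⟩ :=
    exists_kernel_enorm_rpow_le (A := A * ‖realToComplex u‖) (by positivity) hp
  obtain ⟨δ, hδ, hvol⟩ := exists_volume_line_le B hu ha
  obtain ⟨c, hc, hcw⟩ := hw.2 δ hδ
  set E : Set (EuclideanSpace ℝ (Fin d)) := {x | ∀ β ∈ B, δ ≤ |inner ℝ β x|} with hE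
  have hEm : MeasurableSet E := by
    have : E = ⋂ β ∈ B, {x | δ ≤ |inner ℝ β x|} := by ext; simp [hE]
    rw [this]
    refine Finset.measurableSet_biInter _ fun β _ => ?_
    exact (isClosed_le continuous_const (by fun_prop)).measurableSet
  have hfm : Measurable fun x => ‖F (realToComplex x)‖ₑ ^ p :=
    ((hF.continuous.comp continuous_realToComplex).enorm.measurable).pow_const p
  set g : EuclideanSpace ℝ (Fin d) → ℝ≥0∞ := E.indicator fun x => ‖F (realToComplex x)‖ₑ ^ p
    with hg
  have hgm : Measurable g := hfm.indicator hEm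
  have hline : Continuous fun q : EuclideanSpace ℝ (Fin d) × ℝ => q.1 + q.2 • u := by fun_prop
  have hpt : ∀ x, ‖F (realToComplex x)‖ₑ ^ p ≤ ∫⁻ t, g (x + t • u) * k t := fun x => by
    have hEx : MeasurableSet {t : ℝ | x + t • u ∈ E} :=
      (show Continuous fun t : ℝ => x + t • u by fun_prop).measurable hEm
    have := hker _ hEx (hvol x) _ (isExpType_slice_norm hF hA hC (realToComplex x)
      (realToComplex u))
    rw [zero_smul, add_zero, ← lintegral_indicator hEx] at this
    refine this.trans_eq (lintegral_congr fun t => ?_)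
    by_cases ht : x + t • u ∈ E
    · simp [hg, ht, realToComplex_add_smul]
    · simp [hg, ht]
  have hgfin : ∫⁻ x, g x < ∞ := by
    have hle : ∀ x, g x ≤ (ENNReal.ofReal c)⁻¹ *
        (‖F (realToComplex x)‖ₑ ^ p * ENNReal.ofReal (w x)) := fun x => by
      by_cases hx : x ∈ E
      · rw [hg, indicator_of_mem hx, mul_comm, ← ENNReal.div_eq_inv_mul.trans (mul_comm _ _),
          ENNReal.le_div_iff_mul_le (by simp [hc]) (by simp)]
        gcongr
        exact hcw x hx
      · simp [hg, hx]
    refine (lintegral_mono hle).trans_lt ?_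
    rw [lintegral_const_mul' _ _ (by simpa using hc)]
    exact ENNReal.mul_lt_top (by simpa using hc) hfin
  -- After the swap, each inner integral is that of a translate of `g`, so only the mass of the
  -- kernel remains.
  calc ∫⁻ x, ‖F (realToComplex x)‖ₑ ^ p ≤ ∫⁻ x, ∫⁻ t, g (x + t • u) * k t := lintegral_mono hpt
    _ = ∫⁻ t, ∫⁻ x, g (x + t • u) * k t :=
        lintegral_lintegral_swap
          ((hgm.comp hline.measurable).mul (hkm.comp measurable_snd)).aemeasurable
    _ = ∫⁻ t, (∫⁻ x, g x) * k t := by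
        refine lintegral_congr fun t => ?_
        rw [lintegral_mul_const _ (show Measurable fun x => g (x + t • u) from
          hgm.comp (measurable_add_const _)),
          lintegral_add_right_eq_self]
    _ = (∫⁻ x, g x) * ∫⁻ t, k t := lintegral_const_mul _ hkm
    _ < ∞ := ENNReal.mul_lt_top hgfin hk.lt_top

/-- Each coordinate is integrated out in turn, at the cost of one factor `K`. -/
theorem le_pow_card_mul_lmarginal {ι : Type*} [DecidableEq ι] {g : (ι → ℝ) → ℝ≥0∞}
    (hg : Measurable g) {K : ℝ≥0∞}
    (h : ∀ x i, g x ≤ K * ∫⁻ t, g (Function.update x i t)) (s : Finset ι) (x : ι → ℝ) :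
    g x ≤ K ^ s.card * lmarginal (fun _ => volume) s g x := by
  induction s using Finset.induction generalizing x with
  | empty => simp
  | insert i s hi ih =>
    rw [lmarginal_insert _ hg hi, Finset.card_insert_of_notMem hi, pow_succ', mul_assoc,
      ← lintegral_const_mul]
    · exact (h x i).trans (by gcongr; exact ih _)
    · exact (hg.lmarginal _).comp (measurable_update x)

theorem exists_norm_le_of_lintegral_lt_top {p : ℝ} (hp : 0 < p)
    {F : EuclideanSpace ℂ (Fin d) → ℂ}
    (hF : Differentiable ℂ F) {A C : ℝ} (hA : 0 ≤ A) (hC : ∀ z, ‖F z‖ ≤ C * Real.exp (A * ‖z‖))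
    (hfin : ∫⁻ x, ‖F (realToComplex x)‖ₑ ^ p < ∞) :
    ∃ M : ℝ, ∀ x, ‖F (realToComplex x)‖ ≤ M := by
  obtain ⟨a, ha, K, hK, h⟩ := exists_enorm_rpow_le_lintegral hA hp
  set g : (Fin d → ℝ) → ℝ≥0∞ := fun x => ‖F (realToComplex (WithLp.toLp 2 x))‖ₑ ^ p with hg
  have hgm : Measurable g :=
    ((hF.continuous.comp (continuous_realToComplex.comp
      (PiLp.continuous_toLp 2 _))).enorm.measurable).pow_const p
  have hstep : ∀ x i, g x ≤ K * ∫⁻ t, g (Function.update x i t) := fun x i => by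
    -- Resetting coordinate `i` to 0 makes the slice parameter equal to that coordinate, so `x`
    -- itself sits at parameter `x i`.
    have hupd : ∀ t : ℝ, realToComplex (WithLp.toLp 2 (Function.update x i t))
        = realToComplex (WithLp.toLp 2 (Function.update x i 0))
          + (t : ℂ) • EuclideanSpace.single i (1 : ℂ) := fun t => by
      ext j
      by_cases hj : j = i
      · subst hj; simp [realToComplex_apply]
      · simp [realToComplex_apply, hj]
    have hs := isExpType_slice_norm hF hA hC
      (realToComplex (WithLp.toLp 2 (Function.update x i 0))) (EuclideanSpace.single i (1 : ℂ))
    rw [PiLp.norm_single, norm_one, mul_one] at hs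
    have := h univ MeasurableSet.univ (by simp) _ hs (x i)
    simp_rw [← hupd] at this
    simpa [hg] using this
  have hint : ∫⁻ x, g x < ∞ := by
    rwa [hg, (PiLp.volume_preserving_toLp (Fin d)).lintegral_comp
      (f := fun x => ‖F (realToComplex x)‖ₑ ^ p)]
    exact ((hF.continuous.comp continuous_realToComplex).enorm.measurable).pow_const p
  set L : ℝ≥0∞ := K ^ (Finset.univ : Finset (Fin d)).card * ∫⁻ x, g x with hL
  have hLt : L ≠ ∞ := ENNReal.mul_ne_top (ENNReal.pow_ne_top hK) hint.ne
  have hle : ∀ x, g x ≤ L := fun x => by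
    have := le_pow_card_mul_lmarginal hgm hstep Finset.univ x
    rwa [lmarginal_univ, ← volume_pi] at this
  refine ⟨(L ^ (1 / p)).toReal, fun x => ?_⟩
  have h1 : ‖F (realToComplex x)‖ₑ ≤ L ^ (1 / p) := by
    rw [one_div, ENNReal.le_rpow_inv_iff hp]
    exact hle x.ofLp
  rw [← toReal_enorm]
  exact ENNReal.toReal_mono (ENNReal.rpow_ne_top_of_nonneg (by positivity) hLt) h1

/-- The family `N` covers the anisotropic and the spherical growth conditions at once. Along a real
direction the one-variable bound retains only `M`, so the constants for individual ε disappear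
before ε → 0. -/
theorem norm_le_mul_exp_of_bounded {F : EuclideanSpace ℂ (Fin d) → ℂ} (hF : Differentiable ℂ F)
    {M : ℝ} (hM : ∀ x, ‖F (realToComplex x)‖ ≤ M) {N : ℝ → EuclideanSpace ℂ (Fin d) → ℝ}
    (hN : ∀ ε > 0, ∃ c : ℝ, ∀ z, ‖F z‖ ≤ c * Real.exp (N ε z))
    (hsub : ∀ ε > 0, ∀ x y, ∀ ζ : ℂ, N ε (x + ζ • y) ≤ N ε x + ‖ζ‖ * N ε y)
    (hcont : ∀ z, Continuous fun ε => N ε z) (z : EuclideanSpace ℂ (Fin d)) :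
    ‖F z‖ ≤ M * Real.exp (N 0 (realToComplex (imPart z))) := by
  set x : EuclideanSpace ℝ (Fin d) := WithLp.toLp 2 fun i => (z i).re with hx
  have hz : realToComplex x + Complex.I • realToComplex (imPart z) = z := by
    ext i
    simp [hx, realToComplex_apply, imPart_apply, mul_comm Complex.I, Complex.re_add_im]
  have hlim : Tendsto (fun ε => M * Real.exp (N ε (realToComplex (imPart z)))) (𝓝[>] 0)
      (𝓝 (M * Real.exp (N 0 (realToComplex (imPart z))))) :=
    ((continuous_const.mul (Real.continuous_exp.comp (hcont _))).tendsto 0).mono_left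
      nhdsWithin_le_nhds
  refine ge_of_tendsto hlim ?_
  filter_upwards [self_mem_nhdsWithin] with ε hε
  obtain ⟨c, hc⟩ := hN ε hε
  have := norm_le_mul_exp_abs_im (isExpType_slice hF hc (x := realToComplex x)
    (y := realToComplex (imPart z)) (hsub ε hε _ _))
    (fun t => by rw [← realToComplex_add_smul]; exact hM _) Complex.I
  simpa [hz] using this

end SeveralVariables

/-! ### Comparison of the classes -/

section Classes

open Set Filter Topology
open scoped ENNReal

variable {d : ℕ}

theorem IsBoundedBelowOff.exists_norm_le {B : Finset (EuclideanSpace ℝ (Fin d))}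
    {w : EuclideanSpace ℝ (Fin d) → ℝ} (hw : IsBoundedBelowOff B w) {p : ℝ} (hp : 0 < p)
    {f : EuclideanSpace ℝ (Fin d) → ℂ} (hf : f ∈ weightedLp p w)
    {F : EuclideanSpace ℂ (Fin d) → ℂ} (hF : IsEntireExtension f F) {A C : ℝ} (hA : 0 ≤ A)
    (hC : ∀ z, ‖F z‖ ≤ C * Real.exp (A * ‖z‖)) :
    f ∈ weightedLp p (fun _ => 1) ∧ ∃ M : ℝ, ∀ x, ‖F (realToComplex x)‖ ≤ M := by
  obtain ⟨hfm, hfin⟩ := hf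
  obtain rfl : (fun x => F (realToComplex x)) = f := funext hF.2
  have h := lintegral_enorm_rpow_lt_top hp hF.1 hA hC hw hfin
  exact ⟨⟨hfm, by simpa using h⟩, exists_norm_le_of_lintegral_lt_top hp hF.1 hA hC h⟩

theorem sum_mul_norm_le {σ : Fin d → ℝ} (hσ : ∀ i, 0 ≤ σ i) (z : EuclideanSpace ℂ (Fin d)) :
    ∑ i, σ i * ‖z i‖ ≤ (∑ i, σ i) * ‖z‖ := by
  rw [Finset.sum_mul]
  exact Finset.sum_le_sum fun i _ => mul_le_mul_of_nonneg_left (PiLp.norm_apply_le z i) (hσ i)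

theorem nonneg_of_norm_le_mul_exp {F : EuclideanSpace ℂ (Fin d) → ℂ}
    {N : EuclideanSpace ℂ (Fin d) → ℝ} {c : ℝ} (h : ∀ z, ‖F z‖ ≤ c * Real.exp (N z)) : 0 ≤ c :=
  nonneg_of_mul_nonneg_left ((norm_nonneg _).trans (h 0)) (Real.exp_pos _)

theorem anisoClass_subset {B : Finset (EuclideanSpace ℝ (Fin d))}
    {w : EuclideanSpace ℝ (Fin d) → ℝ} (hw : IsBoundedBelowOff B w) {p : ℝ} (hp : 0 < p)
    {σ : Fin d → ℝ} (hσ : ∀ i, 0 < σ i) :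
    anisoClass p w σ ⊆ anisoClass p (fun _ => 1) σ ∩ anisoClassTilde p w σ := by
  rintro f ⟨hf, F, hF, hgrowth⟩
  obtain ⟨C, hC⟩ := hgrowth 1 one_pos
  have hC0 := nonneg_of_norm_le_mul_exp hC
  have hσ1 : ∀ i, 0 ≤ σ i + 1 := fun i => by linarith [hσ i]
  obtain ⟨hf1, M, hM⟩ := hw.exists_norm_le hp hf hF (A := ∑ i, (σ i + 1)) (C := C)
    (Finset.sum_nonneg fun i _ => hσ1 i) fun z => (hC z).trans (by
      gcongr; exact sum_mul_norm_le hσ1 z)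
  refine ⟨⟨hf1, F, hF, hgrowth⟩, hf, F, hF, M, fun z => ?_⟩
  have := norm_le_mul_exp_of_bounded hF.1 hM (N := fun ε z => ∑ i, (σ i + ε) * ‖z i‖) hgrowth
    (fun ε hε x y ζ => ?_) (fun z => by fun_prop) z
  · simpa [realToComplex_apply, imPart_apply] using this
  · rw [Finset.mul_sum, ← Finset.sum_add_distrib]
    refine Finset.sum_le_sum fun i _ => ?_
    have h : ‖(x + ζ • y) i‖ ≤ ‖x i‖ + ‖ζ‖ * ‖y i‖ := by
      simpa using norm_add_le (x i) (ζ * y i)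
    have := mul_le_mul_of_nonneg_left h (show 0 ≤ σ i + ε by linarith [hσ i])
    linarith

theorem anisoClassTilde_subset {w : EuclideanSpace ℝ (Fin d) → ℝ} {p : ℝ}
    {σ : Fin d → ℝ} (hσ : ∀ i, 0 < σ i) : anisoClassTilde p w σ ⊆ anisoClass p w σ := by
  rintro f ⟨hf, F, hF, c, hc⟩
  refine ⟨hf, F, hF, fun ε hε => ⟨c, fun z => (hc z).trans ?_⟩⟩
  have hc0 := nonneg_of_norm_le_mul_exp hc
  refine mul_le_mul_of_nonneg_left (Real.exp_le_exp.2 (Finset.sum_le_sum fun i _ => ?_)) hc0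
  exact mul_le_mul (by linarith) (Complex.abs_im_le_norm _) (abs_nonneg _) (by linarith [hσ i])

theorem norm_imPart_le (z : EuclideanSpace ℂ (Fin d)) : ‖imPart z‖ ≤ ‖z‖ := by
  rw [EuclideanSpace.norm_eq, EuclideanSpace.norm_eq]
  gcongr with i
  exact Complex.abs_im_le_norm (z i)

theorem sphericalClass_eq {B : Finset (EuclideanSpace ℝ (Fin d))}
    {w : EuclideanSpace ℝ (Fin d) → ℝ} (hw : IsBoundedBelowOff B w) {p : ℝ} (hp : 0 < p)
    {σ : ℝ} (hσ : 0 < σ) : sphericalClass p w σ = sphericalClassTilde p w σ := by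
  refine Subset.antisymm ?_ ?_
  · rintro f ⟨hf, F, hF, hgrowth⟩
    obtain ⟨C, hC⟩ := hgrowth 1 one_pos
    obtain ⟨-, M, hM⟩ := hw.exists_norm_le hp hf hF (by positivity) hC
    refine ⟨hf, F, hF, M, fun z => ?_⟩
    have := norm_le_mul_exp_of_bounded hF.1 hM (N := fun ε z => (σ + ε) * ‖z‖) hgrowth
      (fun ε hε x y ζ => ?_) (fun z => by fun_prop) z
    · simpa [norm_realToComplex] using this
    · have h : ‖x + ζ • y‖ ≤ ‖x‖ + ‖ζ‖ * ‖y‖ := (norm_add_le _ _).trans_eq (by rw [norm_smul])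
      have := mul_le_mul_of_nonneg_left h (show 0 ≤ σ + ε by linarith)
      linarith
  · rintro f ⟨hf, F, hF, c, hc⟩
    refine ⟨hf, F, hF, fun ε hε => ⟨c, fun z => (hc z).trans ?_⟩⟩
    have hc0 := nonneg_of_norm_le_mul_exp hc
    refine mul_le_mul_of_nonneg_left (Real.exp_le_exp.2 ?_) hc0
    exact mul_le_mul (by linarith) (norm_imPart_le z) (norm_nonneg _) (by linarith)

/-! ### Lower bounds for the power and Dunkl weights -/

theorem exists_isBoundedBelowOff_powerWeight (hd : 1 ≤ d) {m : ℕ}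
    {α : Fin m → EuclideanSpace ℝ (Fin d)} {k₀ : ℝ} {k : Fin m → ℝ} (hα : ∀ j, α j ≠ 0)
    (hk₀ : 0 ≤ k₀) (hk : ∀ j, 0 < k j) : ∃ B, IsBoundedBelowOff B (powerWeight α k₀ k) := by
  classical
  -- The factor `‖x‖ ^ k₀` vanishes only at the origin; one extra hyperplane, orthogonal to a unit
  -- vector `e`, controls it through `|⟨e, x⟩| ≤ ‖x‖`.
  set e : EuclideanSpace ℝ (Fin d) := EuclideanSpace.single ⟨0, hd⟩ 1 with he
  have hnorm : ‖e‖ = 1 := by simp [he]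
  refine ⟨insert e (Finset.univ.image α), fun β hβ => ?_, fun δ hδ =>
    ⟨δ ^ k₀ * ∏ j, δ ^ k j, by positivity, fun x hx => ?_⟩⟩
  · rcases Finset.mem_insert.1 hβ with rfl | h
    · rw [← norm_pos_iff, hnorm]; exact one_pos
    · obtain ⟨j, -, rfl⟩ := Finset.mem_image.1 h
      exact hα j
  · have h1 : δ ≤ ‖x‖ := by
      have := (hx e (Finset.mem_insert_self _ _)).trans (abs_real_inner_le_norm e x)
      rwa [hnorm, one_mul] at this
    unfold powerWeight
    gcongr with j
    · exact (hk j).le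
    · exact hx _ (Finset.mem_insert_of_mem (Finset.mem_image_of_mem _ (Finset.mem_univ j)))

theorem dunklWeight_nonneg (Rp : Finset (EuclideanSpace ℝ (Fin d)))
    (k : EuclideanSpace ℝ (Fin d) → ℝ) (x : EuclideanSpace ℝ (Fin d)) : 0 ≤ dunklWeight Rp k x :=
  Finset.prod_nonneg fun _ _ => Real.rpow_nonneg (abs_nonneg _) _

theorem continuous_dunklWeight {Rp : Finset (EuclideanSpace ℝ (Fin d))}
    {k : EuclideanSpace ℝ (Fin d) → ℝ} (hk : ∀ a ∈ Rp, 0 ≤ k a) : Continuous (dunklWeight Rp k) :=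
  continuous_finsetProd _ fun a ha =>
    Continuous.rpow_const (by fun_prop) fun _ => Or.inr (by linarith [hk a ha])

theorem dunklWeight_le_exp {Rp : Finset (EuclideanSpace ℝ (Fin d))}
    {k : EuclideanSpace ℝ (Fin d) → ℝ} (hk : ∀ a ∈ Rp, 0 ≤ k a) (x : EuclideanSpace ℝ (Fin d)) :
    dunklWeight Rp k x ≤ Real.exp ((∑ a ∈ Rp, 2 * k a * ‖a‖) * ‖x‖) := by
  rw [Finset.sum_mul, Real.exp_sum]
  refine Finset.prod_le_prod (fun _ _ => Real.rpow_nonneg (abs_nonneg _) _) fun a ha => ?_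
  have hka := hk a ha
  calc |inner ℝ a x| ^ (2 * k a) ≤ Real.exp (‖a‖ * ‖x‖) ^ (2 * k a) := by
        refine Real.rpow_le_rpow (abs_nonneg _) ?_ (by linarith)
        have := Real.add_one_le_exp (‖a‖ * ‖x‖)
        linarith [abs_real_inner_le_norm a x]
    _ = Real.exp (2 * k a * ‖a‖ * ‖x‖) := by
        rw [← Real.exp_mul]; ring_nf

theorem integrable_exp_mul_dunklWeight {Rp : Finset (EuclideanSpace ℝ (Fin d))}
    {k : EuclideanSpace ℝ (Fin d) → ℝ} (hk : ∀ a ∈ Rp, 0 ≤ k a) :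
    Integrable fun x => Real.exp (-‖x‖ ^ 2 / 2) * dunklWeight Rp k x := by
  set L : ℝ := ∑ a ∈ Rp, 2 * k a * ‖a‖ with hL
  have hgauss : Integrable fun x : EuclideanSpace ℝ (Fin d) => Real.exp (-(1 / 4) * ‖x‖ ^ 2) := by
    have := (GaussianFourier.integrable_cexp_neg_mul_sq_norm_add
      (V := EuclideanSpace ℝ (Fin d)) (b := 1 / 4) (by norm_num) 0 0).norm
    refine this.congr (Eventually.of_forall fun x => ?_)
    simp only [Complex.norm_exp]
    congr 1
    have : (-(1 / 4 : ℂ) * (‖x‖ : ℂ) ^ 2 + 0 * (inner ℝ 0 x : ℝ))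
      = ((-(1 / 4) * ‖x‖ ^ 2 : ℝ) : ℂ) := by push_cast; ring
    rw [this, Complex.ofReal_re]
  refine (hgauss.const_mul (Real.exp (L ^ 2))).mono'
    (Continuous.aestronglyMeasurable ?_) (Eventually.of_forall fun x => ?_)
  · exact (by fun_prop : Continuous fun x : EuclideanSpace ℝ (Fin d) =>
      Real.exp (-‖x‖ ^ 2 / 2)).mul (continuous_dunklWeight hk)
  · rw [Real.norm_of_nonneg (mul_nonneg (Real.exp_nonneg _) (dunklWeight_nonneg _ _ _))]
    refine (mul_le_mul_of_nonneg_left (dunklWeight_le_exp hk x) (Real.exp_nonneg _)).trans ?_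
    rw [← Real.exp_add, ← Real.exp_add]
    refine Real.exp_le_exp.2 ?_
    -- Completing the square: `L * ‖x‖ ≤ L ^ 2 + ‖x‖ ^ 2 / 4`.
    nlinarith [sq_nonneg (L - ‖x‖ / 2)]

theorem isBoundedBelowOff_dunklDensity {R Rp : Finset (EuclideanSpace ℝ (Fin d))}
    {k : EuclideanSpace ℝ (Fin d) → ℝ} (hR : IsDunklRootSystem R) (hRp : IsPositiveSubsystem R Rp)
    (hk : IsMultiplicity R k) : IsBoundedBelowOff Rp (dunklDensity Rp k) := by
  obtain ⟨β, -, hβ⟩ := hRp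
  have hk0 : ∀ a ∈ Rp, 0 ≤ k a := fun a ha => hk.1 a ((hβ a).1 ha).1
  -- The normalising integral must be finite and nonzero, or its inverse would be 0. The vector `β`
  -- defining the positive system lies off every hyperplane, so the integrand is nonzero there.
  have hc : 0 < ∫ y, Real.exp (-‖y‖ ^ 2 / 2) * dunklWeight Rp k y := by
    refine integral_pos_of_integrable_nonneg_nonzero (x := β) ?_
      (integrable_exp_mul_dunklWeight hk0)
      (fun x => mul_nonneg (Real.exp_nonneg _) (dunklWeight_nonneg _ _ _)) ?_
    · exact (by fun_prop : Continuous fun x : EuclideanSpace ℝ (Fin d) =>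
        Real.exp (-‖x‖ ^ 2 / 2)).mul (continuous_dunklWeight hk0)
    · refine mul_ne_zero (Real.exp_ne_zero _) (Finset.prod_ne_zero_iff.2 fun a ha => ?_)
      have := ((hβ a).1 ha).2
      rw [real_inner_comm] at this
      exact (Real.rpow_pos_of_pos (abs_pos.2 this.ne') _).ne'
  refine ⟨fun a ha h => hR.zero_notMem (h ▸ ((hβ a).1 ha).1), fun δ hδ =>
    ⟨(∫ y, Real.exp (-‖y‖ ^ 2 / 2) * dunklWeight Rp k y)⁻¹ * ∏ a ∈ Rp, δ ^ (2 * k a),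
      mul_pos (inv_pos.2 hc) (Finset.prod_pos fun a _ => Real.rpow_pos_of_pos hδ _),
      fun x hx => ?_⟩⟩
  refine mul_le_mul_of_nonneg_left (Finset.prod_le_prod
    (fun a _ => Real.rpow_nonneg hδ.le _) fun a ha => ?_) (inv_pos.2 hc).le
  exact Real.rpow_le_rpow hδ.le (hx a ha) (by linarith [hk0 a ha])

end Classes

theorem theorem5p2 (d : ℕ) (hd : 1 ≤ d) (p : ℝ) (hp : 0 < p) :
    (∀ (m : ℕ) (α : Fin m → EuclideanSpace ℝ (Fin d)) (k₀ : ℝ) (k : Fin m → ℝ),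
      (∀ j, α j ≠ 0) → 0 ≤ k₀ → (∀ j, 0 < k j) →
        (∀ σ : Fin d → ℝ, (∀ i, 0 < σ i) →
          anisoClass p (powerWeight α k₀ k) σ ⊆ anisoClass p (fun _ => 1) σ ∧
          anisoClass p (powerWeight α k₀ k) σ = anisoClassTilde p (powerWeight α k₀ k) σ) ∧
        (∀ σ : ℝ, 0 < σ →
          sphericalClass p (powerWeight α k₀ k) σ =
            sphericalClassTilde p (powerWeight α k₀ k) σ)) ∧
    (∀ (R Rp : Finset (EuclideanSpace ℝ (Fin d))) (k : EuclideanSpace ℝ (Fin d) → ℝ),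
      IsDunklRootSystem R → IsPositiveSubsystem R Rp → IsMultiplicity R k →
        ∀ σ : ℝ, 0 < σ →
          sphericalClass p (dunklDensity Rp k) σ =
            sphericalClassTilde p (dunklDensity Rp k) σ) := by
  refine ⟨fun m α k₀ k hα hk₀ hk => ?_, fun R Rp k hR hRp hk σ hσ =>
    sphericalClass_eq (isBoundedBelowOff_dunklDensity hR hRp hk) hp hσ⟩
  obtain ⟨B, hB⟩ := exists_isBoundedBelowOff_powerWeight hd hα hk₀ hk
  refine ⟨fun σ hσ => ?_, fun σ hσ => sphericalClass_eq hB hp hσ⟩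
  have h := anisoClass_subset hB hp hσ
  exact ⟨fun f hf => (h hf).1, Set.Subset.antisymm (fun f hf => (h hf).2)
    (anisoClassTilde_subset hσ)⟩
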